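/- Let $\mathbb K$ be a field, $\mathcal M$ a matroid on $[n]=\{1,\dots,n\}$, and $\beta_{i,j}\in\mathbb K^*$ for $i<j$. Let $\mathbf A$ be the graded $\mathbb K$-algebra generated by $e_1,\dots,e_n$ with relations $e_i^2=0$ and $e_je_i=\beta_{i,j}e_ie_j$ for $i<j$. For $X=\{i_1<\dots<i_m\}$ put $e_X=e_{i_1}\cdots e_{i_m}$ (and $e_\emptyset=1$). Let $\chi:2^{[n]}\to\mathbb K$; for an ordered set $X^\sigma=(i_{\sigma(1)},\dots,i_{\sigma(m)})$ put $\chi(X^\sigma)=\operatorname{sgn}(\sigma)\chi(X)$, and write $\circ$ for concatenation of ordered sets (a set without a specified order being ordered increasingly). Put $\partial e_X=\sum_{p=1}^m(-1)^p\chi(X\setminus i_p)e_{X\setminus i_p}$ if $|X|\ge 2$, and $\partial e_i=1$. A set is *unidependent* if it contains exactly one circuit. Assume that (a) $\chi(I)\neq0$ if and only if $I$ is independent, and (b) for all unidependent sets $U'\subseteq U$ there is $\varepsilon\in\mathbb K^*$ with $\partial e_U=\varepsilon\,(\partial e_{U'})\,e_{U\setminus U'}$. Let $\Im_\chi(\mathcal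 M)$ be the right ideal of $\mathbf A$ generated by the $\partial e_C$, for $C$ a circuit with $|C|>1$, and by the $e_i$, for $i$ a loop. Let $\mathbb A=\mathbb A_\chi(\mathcal M)=\mathbf A/\Im_\chi(\mathcal M)$ be the corresponding $\chi$-algebra, $[X]$ the class of $e_X$ in it, and $\mathbb A_\ell$ the subspace spanned by the $[I]$ with $I$ independent and $|I|=\ell$. For a non-loop $x$ let $\mathbb A(\mathcal M/x)$ be the $\chi$-algebra of the contraction $\mathcal M/x$ for the map $\chi_{\mathcal M/x}(X)=\chi(X\circ x)$, $X\subseteq[n]\setminus x$, and let $\mathfrak p_x:\mathbb A(\mathcal M)\to\mathbb A(\mathcal M/x)$ be the unique linear map such that, for every independent $I$, $$\mathfrak p_x([I])=\begin{cases}[I\setminus x]&\text{if }x\in I,\\ \dfrac{\chi((I\setminus y)\circ x)}{\chi((I\setminus y)\circ y)}\,[I\setminus y]&\text{if some }y\in I\text{ is parallel to }x,\\ 0&\text{otherwise.}\end{cases}$$ For an independent set $I$ of cardinality $\ell$ and an ordering $I^\sigma=(i_{\sigma(1)},\dots,i_{\sigma(\ell)})$ of it, the *iterated residue* $\mathfrak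 p_{I^\sigma}:\mathbb A_\ell\to\mathbb K$ is the composite $\mathfrak p_{i_{\sigma(1)}}\circ\mathfrak p_{i_{\sigma(2)}}\circ\cdots\circ\mathfrak p_{i_{\sigma(\ell)}}$ of the maps for the successive contractions (the last element $i_{\sigma(\ell)}$ is contracted first), where the degree-zero part of $\mathbb A(\mathcal M/I)$ is identified with $\mathbb K$ by $e_\emptyset=1$; and $$\mathbf{Flag}(I^\sigma):\ \operatorname{cl}\{i_{\sigma(\ell)}\}\subsetneq\operatorname{cl}\{i_{\sigma(\ell)},i_{\sigma(\ell-1)}\}\subsetneq\dots\subsetneq\operatorname{cl}\{i_{\sigma(\ell)},\dots,i_{\sigma(1)}\}.$$ Let $\mathbb I_\ell$ be a *diagonal basis* of $\mathbb A_\ell$ in Szenes' sense, that is, a family of independent sets of cardinality $\ell$ such that (1) every $I\in\mathbb I_\ell$ comes with a fixed ordering $I^{\sigma_I}$; (2) $|\mathbb I_\ell|\ge\dim\mathbb A_\ell$; (3) for all $I,J\in\mathbb I_\ell$ and every ordering $J^\tau$ of $J$, the equality $\mathbf{Flag}(J^\tau)=\mathbf{Flag}(I^{\sigma_I})$ implies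 $J=I$. **Theorem.** The classes $[I]$, $I\in\mathbb I_\ell$, form a basis of $\mathbb A_\ell$ (indexed by $\mathbb I_\ell$), and the iterated residues $\mathfrak p_{I^{\sigma_I}}$, $I\in\mathbb I_\ell$, form its dual basis: $\mathfrak p_{I^{\sigma_I}}([J])=\delta_{I,J}$ for all $I,J\in\mathbb I_\ell$. -/

import Mathlib

namespace ChiAlg

variable {n : ℕ} {K : Type*} [Field K]

section FreePart

/-- The defining relations of the graded algebra on `e_1, …, e_n`:
`e_i ^ 2 = 0`, and `e_j e_i = β_{i,j} e_i e_j` for `i < j`. -/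
inductive Rel (β : Fin n → Fin n → Kˣ) :
    FreeAlgebra K (Fin n) → FreeAlgebra K (Fin n) → Prop
  | sq (i : Fin n) : Rel β (FreeAlgebra.ι K i * FreeAlgebra.ι K i) 0
  | comm (i j : Fin n) (hij : i < j) :
      Rel β (FreeAlgebra.ι K j * FreeAlgebra.ι K i)
        ((β i j : K) • (FreeAlgebra.ι K i * FreeAlgebra.ι K j))

/-- The graded `K`-algebra generated by `e_1, …, e_n` subject to `Rel β`. -/
abbrev Free (β : Fin n → Fin n → Kˣ) : Type _ := RingQuot (Rel β)

/-- The generator `e_i`. -/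
noncomputable def gen (β : Fin n → Fin n → Kˣ) (i : Fin n) : Free β :=
  RingQuot.mkAlgHom K (Rel β) (FreeAlgebra.ι K i)

/-- The monomial `e_X = e_{i_1} ⋯ e_{i_m}`, where `X = {i_1 < ⋯ < i_m}`. -/
noncomputable def mon (β : Fin n → Fin n → Kˣ) (X : Finset (Fin n)) : Free β :=
  ((X.sort (· ≤ ·)).map (gen β)).prod

/-- The `χ`-boundary `∂ e_X = ∑_p (-1)^p χ(X \ i_p) e_{X \ i_p}` for `X = {i_1 < ⋯ < i_m}`, with
the convention `∂ e_i = 1`. The position `p` of `i ∈ X` is the number of `j ∈ X` with `j ≤ i`. -/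
noncomputable def boundary (β : Fin n → Fin n → Kˣ) (χ : Finset (Fin n) → K)
    (X : Finset (Fin n)) : Free β :=
  if X.card = 1 then 1
  else ∑ i ∈ X, ((-1 : K) ^ (X.filter (fun j => j ≤ i)).card * χ (X.erase i)) • mon β (X.erase i)

/-- The augmentation `e_i ↦ 0`, i.e. the projection onto the degree-zero part `K`. -/
noncomputable def freeAug (β : Fin n → Fin n → Kˣ) : Free β →ₐ[K] K :=
  RingQuot.liftAlgHom K ⟨FreeAlgebra.lift K (fun _ => (0 : K)), by
    intro a b h
    cases h <;> simp⟩

theorem freeAug_mon (β : Fin n → Fin n → Kˣ) {X : Finset (Fin n)} (hX : X.Nonempty) :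
    freeAug β (mon β X) = 0 := by
  obtain ⟨i, hi⟩ := hX
  have h0 : freeAug β (gen β i) = 0 := by simp [freeAug, gen]
  rw [mon, map_list_prod]
  apply List.prod_eq_zero
  rw [List.map_map, List.mem_map]
  exact ⟨i, by simpa using hi, h0⟩

end FreePart

/-- The ordered sets `X^σ`: the list `L` lists the elements of `X`, each exactly once. -/
def IsOrdering (L : List (Fin n)) (X : Finset (Fin n)) : Prop :=
  L.Nodup ∧ L.toFinset = X

/-- `χ` on ordered sets: `χ(X^σ) = sgn(σ) χ(X)`. (The permutation that sorts `X^σ` is the inverse of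
`σ`, and has the same sign.) -/
noncomputable def chiOrd (χ : Finset (Fin n) → K) (L : List (Fin n)) : K :=
  ((Equiv.Perm.sign (Tuple.sort L.get) : ℤ) : K) * χ L.toFinset

/-- The ordered set `X ∘ x`: `X` in increasing order, followed by `x`. -/
def snoc (X : Finset (Fin n)) (x : Fin n) : List (Fin n) := X.sort (· ≤ ·) ++ [x]

/-- A set is unidependent if it contains exactly one circuit. -/
def Unidependent (M : Matroid (Fin n)) (U : Finset (Fin n)) : Prop :=
  (U : Set (Fin n)) ⊆ M.E ∧ ∃! C : Set (Fin n), M.IsCircuit C ∧ C ⊆ U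

/-- The two conditions on `χ` under which the quotient below is called a `χ`-algebra. -/
structure IsChi (M : Matroid (Fin n)) (β : Fin n → Fin n → Kˣ) (χ : Finset (Fin n) → K) :
    Prop where
  ne_zero_iff : ∀ I : Finset (Fin n), χ I ≠ 0 ↔ M.Indep (I : Set (Fin n))
  boundary_eq : ∀ U U' : Finset (Fin n), Unidependent M U → Unidependent M U' → U' ⊆ U →
    ∃ ε : Kˣ, boundary β χ U = (ε : K) • (boundary β χ U' * mon β (U \ U'))

/-- The generators of the ideal: the boundaries of the circuits with more than one element, and
the loops. When the ground set of `M` is smaller than `[n]` (this happens for contractions), the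
`e_i` outside of it are killed as well, so that only the generators indexed by `M.E` remain. -/
inductive IdealGen (M : Matroid (Fin n)) (β : Fin n → Fin n → Kˣ) (χ : Finset (Fin n) → K) :
    Free β → Prop
  | circuit (C : Finset (Fin n)) (hC : M.IsCircuit (C : Set (Fin n))) (hcard : 1 < C.card) :
      IdealGen M β χ (boundary β χ C)
  | loop (i : Fin n) (hi : M.IsCircuit {i}) : IdealGen M β χ (gen β i)
  | outside (i : Fin n) (hi : i ∉ M.E) : IdealGen M β χ (gen β i)

/-- The right ideal generated by `IdealGen`, as a subspace: the sums of products `g * a` with `g` a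
generator and `a` in the algebra. -/
def chiIdeal (M : Matroid (Fin n)) (β : Fin n → Fin n → Kˣ) (χ : Finset (Fin n) → K) :
    Submodule K (Free β) :=
  Submodule.span K {z | ∃ g a : Free β, IdealGen M β χ g ∧ z = g * a}

/-- The quotient `𝔸_χ(M)` (as a vector space; the ideal is a right ideal). -/
abbrev ChiAlgebra (M : Matroid (Fin n)) (β : Fin n → Fin n → Kˣ) (χ : Finset (Fin n) → K) :
    Type _ :=
  Free β ⧸ chiIdeal M β χ

/-- The class `[X]` of `e_X` in `𝔸_χ(M)`. -/
noncomputable def cls (M : Matroid (Fin n)) (β : Fin n → Fin n → Kˣ) (χ : Finset (Fin n) → K)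
    (X : Finset (Fin n)) : ChiAlgebra M β χ :=
  (chiIdeal M β χ).mkQ (mon β X)

/-- The component `𝔸_ℓ`, spanned by the `[I]` with `I` independent of cardinality `ℓ`. -/
noncomputable def component (M : Matroid (Fin n)) (β : Fin n → Fin n → Kˣ)
    (χ : Finset (Fin n) → K) (ℓ : ℕ) : Submodule K (ChiAlgebra M β χ) :=
  Submodule.span K
    {a | ∃ I : Finset (Fin n), M.Indep (I : Set (Fin n)) ∧ I.card = ℓ ∧ a = cls M β χ I}

theorem cls_mem_component (M : Matroid (Fin n)) (β : Fin n → Fin n → Kˣ)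
    (χ : Finset (Fin n) → K) {ℓ : ℕ} {I : Finset (Fin n)} (hI : M.Indep (I : Set (Fin n)))
    (hcard : I.card = ℓ) : cls M β χ I ∈ component M β χ ℓ :=
  Submodule.subset_span ⟨I, hI, hcard, rfl⟩

theorem chiIdeal_le_ker (M : Matroid (Fin n)) (β : Fin n → Fin n → Kˣ)
    (χ : Finset (Fin n) → K) :
    chiIdeal M β χ ≤ LinearMap.ker (freeAug β).toLinearMap := by
  rw [chiIdeal, Submodule.span_le]
  rintro z ⟨g, a, hg, rfl⟩
  have hgen : ∀ i, freeAug β (gen β i) = 0 := fun i => by simp [freeAug, gen]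
  have h0 : freeAug β g = 0 := by
    cases hg with
    | circuit C hC hcard =>
      rw [boundary, if_neg (by omega), map_sum]
      refine Finset.sum_eq_zero fun i hi => ?_
      rw [map_smul, freeAug_mon β, smul_zero]
      rw [← Finset.card_pos, Finset.card_erase_of_mem hi]
      omega
    | loop i hi => exact hgen i
    | outside i hi => exact hgen i
  simp [h0]

/-- The projection of `𝔸_χ(M)` onto its degree-zero part, which is identified with `K` by
`e_∅ = 1`. -/
noncomputable def degreeZero (M : Matroid (Fin n)) (β : Fin n → Fin n → Kˣ)
    (χ : Finset (Fin n) → K) : ChiAlgebra M β χ →ₗ[K] K :=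
  (chiIdeal M β χ).liftQ (freeAug β).toLinearMap (chiIdeal_le_ker M β χ)

/-- The map `χ_{M/x}(X) = χ(X ∘ x)` on the subsets `X` of the ground set of `M / x`, extended by `0`
to the sets that contain `x`. -/
noncomputable def chiContract (χ : Finset (Fin n) → K) (x : Fin n) : Finset (Fin n) → K :=
  fun X => if x ∈ X then 0 else chiOrd χ (snoc X x)

/-- `x` and `y` are parallel: they are distinct and form a circuit. -/
def Parallel (M : Matroid (Fin n)) (x y : Fin n) : Prop :=
  x ≠ y ∧ M.IsCircuit {x, y}

/-- The three-case formula that determines the linear map `𝔭_x : 𝔸(M) → 𝔸(M/x)`. -/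
structure IsResidue (M : Matroid (Fin n)) (β : Fin n → Fin n → Kˣ) (χ : Finset (Fin n) → K)
    (x : Fin n) (f : ChiAlgebra M β χ →ₗ[K] ChiAlgebra (M.contract {x}) β (chiContract χ x)) :
    Prop where
  of_mem : ∀ I : Finset (Fin n), M.Indep (I : Set (Fin n)) → x ∈ I →
    f (cls M β χ I) = cls (M.contract {x}) β (chiContract χ x) (I.erase x)
  of_parallel : ∀ I : Finset (Fin n), M.Indep (I : Set (Fin n)) → ∀ y ∈ I, Parallel M x y →
    f (cls M β χ I) = (chiOrd χ (snoc (I.erase y) x) / chiOrd χ (snoc (I.erase y) y)) •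
      cls (M.contract {x}) β (chiContract χ x) (I.erase y)
  otherwise : ∀ I : Finset (Fin n), M.Indep (I : Set (Fin n)) → x ∉ I →
    (∀ y ∈ I, ¬ Parallel M x y) → f (cls M β χ I) = 0

open Classical in
/-- The residue `𝔭_x : 𝔸(M) → 𝔸(M/x)`, the linear map given by the formula `IsResidue`. There is at
most one such map, since the `[I]` with `I` independent span `𝔸(M)`; if there were none, the value
would be `0`. -/
noncomputable def residue (M : Matroid (Fin n)) (β : Fin n → Fin n → Kˣ)
    (χ : Finset (Fin n) → K) (x : Fin n) :
    ChiAlgebra M β χ →ₗ[K] ChiAlgebra (M.contract {x}) β (chiContract χ x) :=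
  if h : ∃ f, IsResidue M β χ x f then h.choose else 0

/-- Successive residues with respect to the elements of a list, the head of the list first, followed
by the identification of degree zero with `K`. -/
noncomputable def residues (β : Fin n → Fin n → Kˣ) :
    (L : List (Fin n)) → (M : Matroid (Fin n)) → (χ : Finset (Fin n) → K) →
      (ChiAlgebra M β χ →ₗ[K] K)
  | [], M, χ => degreeZero M β χ
  | x :: L, M, χ => (residues β L (M.contract {x}) (chiContract χ x)).comp (residue M β χ x)

/-- The iterated residue `𝔭_{I^σ} = 𝔭_{i_{σ(1)}} ∘ ⋯ ∘ 𝔭_{i_{σ(ℓ)}}`, a linear form on `𝔸_ℓ`. The last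
element of the ordered set `I^σ` is contracted first. -/
noncomputable def iteratedResidue (M : Matroid (Fin n)) (β : Fin n → Fin n → Kˣ)
    (χ : Finset (Fin n) → K) (ℓ : ℕ) (L : List (Fin n)) :
    Module.Dual K (component M β χ ℓ) :=
  (residues β L.reverse M χ).domRestrict (component M β χ ℓ)

/-- The flag of flats `cl{i_{σ(ℓ)}} ⊂ cl{i_{σ(ℓ)}, i_{σ(ℓ-1)}} ⊂ ⋯ ⊂ cl{i_{σ(ℓ)}, …, i_{σ(1)}}` of an
ordered set `(i_{σ(1)}, …, i_{σ(ℓ)})`. -/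
def flag (M : Matroid (Fin n)) : List (Fin n) → List (Set (Fin n))
  | [] => []
  | x :: L => flag M L ++ [M.closure {y | y ∈ x :: L}]

/-- A family `𝕀` of independent sets of cardinality `ℓ`, with an ordering `ord I` of each member `I`,
is a diagonal basis of `𝔸_ℓ`. -/
structure IsDiagonalBasis (M : Matroid (Fin n)) (β : Fin n → Fin n → Kˣ)
    (χ : Finset (Fin n) → K) (ℓ : ℕ) (𝕀 : Finset (Finset (Fin n)))
    (ord : Finset (Fin n) → List (Fin n)) : Prop where
  indep : ∀ I ∈ 𝕀, M.Indep (I : Set (Fin n))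
  card_eq : ∀ I ∈ 𝕀, I.card = ℓ
  ordering : ∀ I ∈ 𝕀, IsOrdering (ord I) I
  finrank_le : Module.finrank K (component M β χ ℓ) ≤ 𝕀.card
  eq_of_flag_eq : ∀ I ∈ 𝕀, ∀ J ∈ 𝕀, ∀ L : List (Fin n), IsOrdering L J →
    flag M L = flag M (ord I) → J = I

end ChiAlg

/-! The heart of the matter is the pairing `𝔭_{I^σ}([J])`, computed by contracting one element at a
time. A residue at `x` sends `[J]` to a multiple of `[J \ y]` with `y ∈ J` equal or parallel to `x`,
and to zero if there is no such `y`. For `J = I` every step is of the form `I ↦ I \ x` with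
coefficient 1, so the value is 1 (`residues_toFinset`). If the value is nonzero, the elements `y`
removed successively give an ordering of `J`; at each step `y` and `x` have the same closure in the
current contraction, so this ordering has the flag of `I^σ` (`exists_ordering_of_residues_ne_zero`).
Condition (3) then forces `J = I`. The pairing matrix is thus the identity, the `[I]` are
independent, and the cardinality bound (2) makes them a basis.

This requires the residue to exist and `χ`-algebras to be stable under contraction. Stability
(`IsChi.contract`) is a comparison of coefficients in the monomial basis of the free algebra. For
existence, a linear map is prescribed on monomials (`residueLift`), where it is unconstrained, and
is shown to kill the ideal (`chiIdeal_le_ker_residueLift`). By (b) the essential case is the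
boundary of a loopless unidependent set `U`, whose image is a signed sum over deletions of `i` and
then of `y` in the parallel class of `x`. If that class meets `U` at least twice, the terms cancel
in pairs as in `∂∂ = 0`; if it meets `U` in one `y` only, the sum is up to sign the boundary of `U \
y` in `M/x`, which is zero in the quotient. -/

namespace ChiAlg

variable {n : ℕ} {K : Type*} [Field K]

/-! ### The monomial basis of the free algebra -/

section Monomials

variable (β : Fin n → Fin n → Kˣ)

/-- The coefficient in `e_i e_Y = moveCoeff i Y • e_{Y ∪ i}`. -/
noncomputable def moveCoeff (i : Fin n) (Y : Finset (Fin n)) : K :=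
  ∏ j ∈ Y with j < i, (β j i : K)

/-- The coefficient in `e_X e_Y = mulCoeff X Y • e_{X ∪ Y}`. -/
noncomputable def mulCoeff (X Y : Finset (Fin n)) : K := ∏ i ∈ X, moveCoeff β i Y

theorem moveCoeff_ne_zero (i : Fin n) (Y : Finset (Fin n)) : moveCoeff β i Y ≠ 0 :=
  Finset.prod_ne_zero_iff.2 fun _ _ => Units.ne_zero _

theorem moveCoeff_of_forall_lt {i : Fin n} {Y : Finset (Fin n)} (h : ∀ j ∈ Y, i < j) :
    moveCoeff β i Y = 1 := by
  rw [moveCoeff, Finset.filter_false_of_mem, Finset.prod_empty]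
  exact fun j hj => (h j hj).not_gt

theorem moveCoeff_insert {i a : Fin n} {Y : Finset (Fin n)} (ha : a ∉ Y) :
    moveCoeff β i (insert a Y) = (if a < i then (β a i : K) else 1) * moveCoeff β i Y := by
  rw [moveCoeff, Finset.filter_insert]
  split_ifs
  · rw [Finset.prod_insert (by simp [ha])]; rfl
  · rw [one_mul]; rfl

theorem gen_mul_self (i : Fin n) : gen β i * gen β i = 0 := by
  rw [gen, ← map_mul, RingQuot.mkAlgHom_rel K (Rel.sq i), map_zero]

theorem gen_mul_gen {i j : Fin n} (h : i < j) :
    gen β j * gen β i = (β i j : K) • (gen β i * gen β j) := by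
  simp only [gen]
  rw [← map_mul, RingQuot.mkAlgHom_rel K (Rel.comm i j h), map_smul, map_mul]

@[simp] theorem mon_empty : mon β ∅ = 1 := by simp [mon]

theorem mon_insert_of_forall_lt {a : Fin n} {s : Finset (Fin n)} (h : ∀ x ∈ s, a < x) :
    mon β (insert a s) = gen β a * mon β s := by
  rw [mon, Finset.sort_insert _ (fun b hb => (h b hb).le) (fun ha => (h a ha).false)]
  simp [mon]

theorem mon_singleton (i : Fin n) : mon β {i} = gen β i := by simp [mon]

theorem gen_mul_mon (i : Fin n) (Y : Finset (Fin n)) :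
    gen β i * mon β Y = if i ∈ Y then 0 else moveCoeff β i Y • mon β (insert i Y) := by
  induction Y using Finset.induction_on_min with
  | empty => simp [moveCoeff, mon_singleton]
  | insert a s hs ih =>
    have has : a ∉ s := fun h => (hs a h).false
    rw [mon_insert_of_forall_lt β hs, ← mul_assoc]
    rcases lt_trichotomy i a with h | rfl | h
    · have hlt : ∀ x ∈ insert a s, i < x := by
        simp only [Finset.mem_insert, forall_eq_or_imp]
        exact ⟨h, fun x hx => h.trans (hs x hx)⟩
      rw [if_neg (fun hi => (hlt i hi).false), moveCoeff_of_forall_lt β hlt, one_smul,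
        mon_insert_of_forall_lt β hlt, mon_insert_of_forall_lt β hs, mul_assoc]
    · simp [gen_mul_self]
    · rw [gen_mul_gen β h, smul_mul_assoc, mul_assoc, ih]
      by_cases his : i ∈ s
      · simp [his]
      · rw [if_neg his, if_neg (by simp [his, h.ne']), moveCoeff_insert β has, if_pos h,
          mul_smul_comm, smul_smul, Finset.insert_comm i a,
          mon_insert_of_forall_lt β (a := a) (s := insert i s)]
        simp only [Finset.mem_insert, forall_eq_or_imp]
        exact ⟨h, hs⟩

theorem mon_mul_mon (X Y : Finset (Fin n)) :
    mon β X * mon β Y = if Disjoint X Y then mulCoeff β X Y • mon β (X ∪ Y) else 0 := by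
  induction X using Finset.induction_on_min with
  | empty => simp [mulCoeff]
  | insert a s hs ih =>
    have has : a ∉ s := fun h => (hs a h).false
    rw [mon_insert_of_forall_lt β hs, mul_assoc, ih]
    simp only [Finset.disjoint_insert_left]
    by_cases hd : Disjoint s Y
    · rw [if_pos hd, mul_smul_comm, gen_mul_mon]
      by_cases haY : a ∈ Y
      · simp [haY]
      · rw [if_neg (by simp [has, haY]), if_pos ⟨haY, hd⟩, smul_smul, Finset.insert_union, mulCoeff,
          mulCoeff, Finset.prod_insert has, mul_comm]
        congr 2
        rw [moveCoeff, moveCoeff, Finset.filter_union, Finset.filter_false_of_mem (s := s),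
          Finset.empty_union]
        exact fun j hj => (hs j hj).not_gt
    · simp [hd]

/-- The operator `e_i` on the space with basis the subsets of `[n]`. -/
noncomputable def genOp (i : Fin n) : Module.End K (Finset (Fin n) →₀ K) :=
  Finsupp.linearCombination K fun Y =>
    if i ∈ Y then 0 else Finsupp.single (insert i Y) (moveCoeff β i Y)

theorem genOp_single (i : Fin n) (Y : Finset (Fin n)) (c : K) :
    genOp β i (Finsupp.single Y c) =
      if i ∈ Y then 0 else Finsupp.single (insert i Y) (c * moveCoeff β i Y) := by
  rw [genOp, Finsupp.linearCombination_single]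
  split_ifs <;> simp

/-- The regular representation of `Free β` in the monomial basis. -/
noncomputable def regularRep : Free β →ₐ[K] Module.End K (Finset (Fin n) →₀ K) :=
  RingQuot.liftAlgHom K ⟨FreeAlgebra.lift K (genOp β), by
    intro a b h
    cases h with
    | sq i =>
      rw [map_mul, FreeAlgebra.lift_ι_apply, map_zero]
      refine Finsupp.lhom_ext fun Y c => ?_
      rw [Module.End.mul_apply, genOp_single]
      split_ifs
      · simp
      · rw [genOp_single]; simp
    | comm i j hij =>
      rw [map_smul, map_mul, map_mul, FreeAlgebra.lift_ι_apply, FreeAlgebra.lift_ι_apply]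
      refine Finsupp.lhom_ext fun Y c => ?_
      rw [LinearMap.smul_apply, Module.End.mul_apply, Module.End.mul_apply, genOp_single,
        genOp_single]
      by_cases hi : i ∈ Y <;> by_cases hj : j ∈ Y <;>
        simp only [hi, hj, if_true, if_false, map_zero, smul_zero, genOp_single,
          Finset.mem_insert, or_true, or_false, hij.ne, hij.ne']
      rw [moveCoeff_insert β hi, moveCoeff_insert β hj, if_pos hij, if_neg hij.not_gt,
        Finsupp.smul_single, smul_eq_mul, Finset.insert_comm]
      congr 1
      ring⟩

/-- The coordinates in the monomial basis. -/
noncomputable def coords : Free β →ₗ[K] (Finset (Fin n) →₀ K) :=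
  (LinearMap.applyₗ (Finsupp.single ∅ 1)).comp (regularRep β).toLinearMap

/-- Applying the regular representation of `e_X` to the basis vector at `∅` rebuilds `X` from its
largest element down, so no reordering factor appears. Hence the monomials are linearly independent:
linear maps may be prescribed on them and coefficients compared. -/
theorem coords_mon (X : Finset (Fin n)) : coords β (mon β X) = Finsupp.single X 1 := by
  have hgen : ∀ i, regularRep β (gen β i) = genOp β i := fun i => by
    simp [regularRep, gen]
  simp only [coords, LinearMap.comp_apply, LinearMap.applyₗ_apply_apply, AlgHom.toLinearMap_apply]
  induction X using Finset.induction_on_min with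
  | empty => simp
  | insert a s hs ih =>
    rw [mon_insert_of_forall_lt β hs, map_mul, Module.End.mul_apply, ih, hgen, genOp_single,
      if_neg (fun h => (hs a h).false), moveCoeff_of_forall_lt β hs, one_mul]

theorem span_mon : Submodule.span K (Set.range (mon β)) = ⊤ := by
  rw [eq_top_iff]
  rintro z -
  -- The span contains 1, so it suffices that it be a left ideal; stability under left
  -- multiplication is the form that passes to products.
  suffices h : ∀ w : FreeAlgebra K (Fin n), ∀ s ∈ Submodule.span K (Set.range (mon β)),
      RingQuot.mkAlgHom K (Rel β) w * s ∈ Submodule.span K (Set.range (mon β)) by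
    obtain ⟨w, rfl⟩ := RingQuot.mkAlgHom_surjective K (Rel β) z
    simpa using h w 1 (Submodule.subset_span ⟨∅, mon_empty β⟩)
  intro w
  induction w using FreeAlgebra.induction with
  | grade0 r =>
    intro s hs
    rw [AlgHom.commutes, ← Algebra.smul_def]
    exact Submodule.smul_mem _ _ hs
  | grade1 i =>
    intro s hs
    induction hs using Submodule.span_induction with
    | mem x hx =>
      obtain ⟨Y, rfl⟩ := hx
      change gen β i * _ ∈ _
      rw [gen_mul_mon]
      split_ifs
      · exact zero_mem _
      · exact Submodule.smul_mem _ _ (Submodule.subset_span ⟨_, rfl⟩)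
    | zero => simp
    | add x y _ _ hx hy => rw [mul_add]; exact add_mem hx hy
    | smul c x _ hx => rw [mul_smul_comm]; exact Submodule.smul_mem _ _ hx
  | mul a b ha hb =>
    intro s hs
    rw [map_mul, mul_assoc]
    exact ha _ (hb _ hs)
  | add a b ha hb =>
    intro s hs
    rw [map_add, add_mul]
    exact add_mem (ha _ hs) (hb _ hs)

end Monomials

/-! ### Signs of positions and of ordered sets -/

section Signs

/-- The sign `(-1)^p` of the position `p` of `i` in `X`. -/
def posSign (K : Type*) [Field K] (i : Fin n) (X : Finset (Fin n)) : K :=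
  (-1) ^ (X.filter (fun j => j ≤ i)).card

/-- The sign of the permutation that sorts `X ∘ y`. -/
def tailSign (K : Type*) [Field K] (y : Fin n) (X : Finset (Fin n)) : K :=
  (-1) ^ (X.filter (fun j => y < j)).card

theorem posSign_ne_zero (i : Fin n) (X : Finset (Fin n)) : posSign K i X ≠ 0 :=
  pow_ne_zero _ (neg_ne_zero.2 one_ne_zero)

theorem tailSign_ne_zero (i : Fin n) (X : Finset (Fin n)) : tailSign K i X ≠ 0 :=
  pow_ne_zero _ (neg_ne_zero.2 one_ne_zero)

theorem tailSign_mul_self (i : Fin n) (X : Finset (Fin n)) :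
    tailSign K i X * tailSign K i X = 1 := by
  rw [tailSign, ← mul_pow]; simp

theorem posSign_insert {i a : Fin n} {X : Finset (Fin n)} (ha : a ∉ X) :
    posSign K i (insert a X) = (if a ≤ i then -1 else 1) * posSign K i X := by
  rw [posSign, Finset.filter_insert]
  split_ifs
  · rw [Finset.card_insert_of_notMem (by simp [ha]), pow_succ']; rfl
  · rw [one_mul]; rfl

theorem tailSign_insert {i a : Fin n} {X : Finset (Fin n)} (ha : a ∉ X) :
    tailSign K i (insert a X) = (if i < a then -1 else 1) * tailSign K i X := by
  rw [tailSign, Finset.filter_insert]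
  split_ifs
  · rw [Finset.card_insert_of_notMem (by simp [ha]), pow_succ']; rfl
  · rw [one_mul]; rfl

theorem posSign_mul_tailSign (i : Fin n) (X : Finset (Fin n)) :
    posSign K i X * tailSign K i X = (-1) ^ X.card := by
  rw [posSign, tailSign, ← pow_add]
  simp only [← not_le]
  rw [Finset.card_filter_add_card_filter_not]

/-- Adjoining `x` changes the sign of the position of `i` exactly when `x < i`, and this is also
when deleting `i` changes the tail sign of `x`. -/
theorem posSign_insert_mul_tailSign_erase {x i : Fin n} {U : Finset (Fin n)} (hx : x ∉ U)
    (hi : i ∈ U) :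
    posSign K i (insert x U) * tailSign K x (U.erase i) = tailSign K x U * posSign K i U := by
  obtain ⟨V, hV, rfl⟩ : ∃ V, i ∉ V ∧ insert i V = U :=
    ⟨U.erase i, Finset.notMem_erase _ _, Finset.insert_erase hi⟩
  have hne : x ≠ i := fun h => hx (h ▸ hi)
  rw [Finset.erase_insert hV, posSign_insert hx, tailSign_insert hV]
  rcases hne.lt_or_gt with h | h
  · rw [if_pos h.le, if_pos h]; ring
  · rw [if_neg h.not_ge, if_neg h.not_gt]; ring

theorem posSign_mul_tailSign_erase {x i : Fin n} {U : Finset (Fin n)} (hx : x ∉ U)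
    (hi : i ∈ U) :
    posSign K i U * tailSign K x (U.erase i) = tailSign K x U * posSign K i (insert x U) := by
  linear_combination
    (-tailSign K x U * tailSign K x (U.erase i)) * posSign_insert_mul_tailSign_erase (K := K) hx hi +
    (tailSign K x U * posSign K i (insert x U)) * tailSign_mul_self (K := K) x (U.erase i) -
    (posSign K i U * tailSign K x (U.erase i)) * tailSign_mul_self (K := K) x U

/-- The antisymmetry behind `∂∂ = 0`: exactly one of `i`, `y` has its position shifted by the
presence of the other. -/
theorem posSign_mul_tailSign_swap {i y : Fin n} {W : Finset (Fin n)} (hi : i ∉ W) (hy : y ∉ W)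
    (hne : i ≠ y) :
    posSign K i (insert i (insert y W)) * tailSign K y W =
      -(posSign K y (insert i (insert y W)) * tailSign K i W) := by
  -- For either element, position sign times tail sign is `(-1)^|W|`; the tail signs have square 1.
  have h : posSign K i W * tailSign K y W = posSign K y W * tailSign K i W := by
    have h1 := posSign_mul_tailSign (K := K) i W
    have h2 := posSign_mul_tailSign (K := K) y W
    have h3 := tailSign_mul_self (K := K) i W
    have h4 := tailSign_mul_self (K := K) y W
    linear_combination (tailSign K i W * tailSign K y W) * (h1 - h2) -
      posSign K i W * tailSign K y W * h3 + posSign K y W * tailSign K i W * h4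
  rw [posSign_insert (by simp [hi, hne]), posSign_insert hy, posSign_insert (by simp [hi, hne]),
    posSign_insert hy, if_pos le_rfl, if_pos le_rfl]
  rcases hne.lt_or_gt with h' | h'
  · rw [if_pos h'.le, if_neg h'.not_ge]; linear_combination -h
  · rw [if_pos h'.le, if_neg h'.not_ge]; linear_combination h

/-- The sign counts inversions: the inverse of the sorting permutation compares two positions as `f`
compares their values. -/
theorem sign_sort {m : ℕ} {f : Fin m → Fin n} (hf : Function.Injective f) :
    Equiv.Perm.sign (Tuple.sort f) = ∏ j, ∏ i ∈ Finset.Iio j, (if f i < f j then 1 else -1) := by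
  have hs : StrictMono (f ∘ Tuple.sort f) :=
    (Tuple.monotone_sort f).strictMono_of_injective (hf.comp (Equiv.injective _))
  rw [← Equiv.Perm.sign_inv, Equiv.Perm.sign_eq_prod_prod_Iio]
  refine Finset.prod_congr rfl fun j _ => Finset.prod_congr rfl fun i _ => ?_
  have := hs.lt_iff_lt (a := (Tuple.sort f)⁻¹ i) (b := (Tuple.sort f)⁻¹ j)
  simp only [Function.comp_apply, Equiv.Perm.inv_def, Equiv.apply_symm_apply] at this
  simp only [Equiv.Perm.inv_def, this]

theorem sign_sort_get {m : ℕ} (L : List (Fin n)) (hm : L.length = m) (g : Fin m → Fin n)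
    (h : ∀ i : Fin m, L.get (i.cast hm.symm) = g i) :
    Equiv.Perm.sign (Tuple.sort L.get) = Equiv.Perm.sign (Tuple.sort g) := by
  subst hm
  rw [show g = L.get from funext fun i => (h i).symm]

/-- The only inversions of `Z ∘ y` are the pairs formed by `y` and an element of `Z` above it. All
later signs of ordered sets go through this formula. -/
theorem chiOrd_snoc (χ : Finset (Fin n) → K) {Z : Finset (Fin n)} {y : Fin n} (hy : y ∉ Z) :
    chiOrd χ (snoc Z y) = tailSign K y Z * χ (insert y Z) := by
  set g : Fin (Z.card + 1) → Fin n :=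
    Fin.snoc (α := fun _ => Fin n) (fun i => Z.orderEmbOfFin rfl i) y with hg
  have hlast : g (Fin.last _) = y := by simp [hg]
  have hcast : ∀ i : Fin Z.card, g i.castSucc = Z.orderEmbOfFin rfl i := fun i => by simp [hg]
  have hginj : Function.Injective g := by
    rw [hg, Fin.snoc_injective_iff]
    refine ⟨(Z.orderEmbOfFin rfl).injective, ?_⟩
    rintro ⟨i, rfl⟩
    exact hy (Finset.orderEmbOfFin_mem _ _ _)
  have hsign : (Equiv.Perm.sign (Tuple.sort (snoc Z y).get) : ℤˣ) =
      (-1) ^ (Z.filter (fun j => y < j)).card := by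
    rw [sign_sort_get (snoc Z y) (m := Z.card + 1) (by simp [snoc]) g, sign_sort hginj,
      Fin.prod_univ_castSucc]
    -- The pairs inside `Z` contribute 1, since `Z` is listed increasingly; only the pairs with the
    -- last entry remain.
    · rw [Finset.prod_eq_one, one_mul]
      · have h1 : (Finset.Iio (Fin.last Z.card)) =
            Finset.univ.map (Fin.castSuccEmb (n := Z.card)) := by
          ext i
          refine Fin.lastCases ?_ (fun j => ?_) i
          · simp [Fin.castSucc_ne_last]
          · simp
        rw [h1, Finset.prod_map]
        simp only [Fin.coe_castSuccEmb, hlast, hcast]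
        have h2 := Finset.prod_image (s := Finset.univ) (g := Z.orderEmbOfFin rfl)
          (f := fun z => if z < y then (1 : ℤˣ) else -1) (Z.orderEmbOfFin rfl).injective.injOn
        rw [← h2, Finset.image_orderEmbOfFin_univ, Finset.prod_ite, Finset.prod_const_one,
          one_mul, Finset.prod_const]
        congr 2
        refine Finset.filter_congr fun z hz => ?_
        have : z ≠ y := fun h => hy (h ▸ hz)
        omega
      · intro j _
        refine Finset.prod_eq_one fun i hi => ?_
        rw [Finset.mem_Iio] at hi
        have hne : i ≠ Fin.last _ := (hi.trans (Fin.castSucc_lt_last j)).ne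
        obtain ⟨i', rfl⟩ := Fin.exists_castSucc_eq.2 hne
        rw [if_pos]
        rw [hcast, hcast]
        exact (Z.orderEmbOfFin rfl).strictMono (by simpa using hi)
    · intro i
      refine Fin.lastCases ?_ (fun j => ?_) i
      · rw [hlast]
        simp only [snoc, List.get_eq_getElem]
        exact List.getElem_concat_length (Finset.length_sort _).symm _
      · rw [hcast, Finset.orderEmbOfFin_apply]
        simp only [snoc, List.get_eq_getElem]
        exact List.getElem_append_left (j.2.trans_eq (Finset.length_sort _).symm)
  rw [chiOrd, hsign, tailSign]
  congr 1
  · push_cast; rfl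
  · congr 1
    ext; simp [snoc]

theorem chiContract_of_notMem (χ : Finset (Fin n) → K) {Z : Finset (Fin n)} {x : Fin n}
    (hx : x ∉ Z) : chiContract χ x Z = tailSign K x Z * χ (insert x Z) := by
  rw [chiContract, if_neg hx, chiOrd_snoc χ hx]

end Signs

/-! ### Unidependent sets and contraction -/

section Unidependent

variable {M : Matroid (Fin n)}

/-- Deleting an element of the only circuit leaves no circuit. Conversely, if `U \ i` is
independent, any circuit in `U` is the fundamental circuit of `i`. -/
theorem unidependent_iff {U : Finset (Fin n)} :
    Unidependent M U ↔ (U : Set (Fin n)) ⊆ M.E ∧ ¬ M.Indep (U : Set (Fin n)) ∧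
      ∃ i ∈ U, M.Indep (U.erase i : Set (Fin n)) := by
  refine and_congr_right fun hE => ⟨?_, ?_⟩
  · rintro ⟨C, ⟨hC, hCU⟩, huniq⟩
    refine ⟨fun h => hC.not_indep (h.subset hCU), ?_⟩
    obtain ⟨i, hi⟩ := hC.nonempty
    refine ⟨i, hCU hi, ?_⟩
    rw [Matroid.indep_iff_forall_subset_not_isCircuit
      ((Finset.coe_subset.2 (Finset.erase_subset _ _)).trans hE)]
    intro D hD hDC
    obtain rfl := huniq D ⟨hDC, hD.trans (Finset.coe_subset.2 (Finset.erase_subset _ _))⟩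
    simpa using hD hi
  · rintro ⟨hU, i, hi, hI⟩
    obtain ⟨C, hCU, hC⟩ := Matroid.Dep.exists_isCircuit_subset (M := M) ⟨hU, hE⟩
    have key : ∀ D, M.IsCircuit D → D ⊆ U → D = M.fundCircuit i (U.erase i : Finset _) := by
      refine fun D hD hDU => hD.eq_fundCircuit_of_subset hI ?_
      rwa [← Finset.coe_insert, Finset.insert_erase hi]
    exact ⟨C, ⟨hC, hCU⟩, fun D hD => (key D hD.1 hD.2).trans (key C hC hCU).symm⟩

theorem Unidependent.exists_circuit {U : Finset (Fin n)} (hU : Unidependent M U) :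
    ∃ C : Finset (Fin n), M.IsCircuit (C : Set (Fin n)) ∧ C ⊆ U := by
  classical
  obtain ⟨C, ⟨hC, hCU⟩, -⟩ := hU.2
  refine ⟨C.toFinset, by simpa using hC, ?_⟩
  rw [← Finset.coe_subset]
  simpa using hCU

theorem unidependent_of_isCircuit {C : Finset (Fin n)} (hC : M.IsCircuit (C : Set (Fin n))) :
    Unidependent M C :=
  ⟨hC.subset_ground, C, ⟨hC, subset_rfl⟩, fun _ hD =>
    (hC.eq_of_superset_isCircuit hD.1 hD.2).symm⟩

theorem contract_indep_iff {x : Fin n} (hx : M.IsNonloop x) {X : Finset (Fin n)} :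
    (M.contract {x}).Indep (X : Set (Fin n)) ↔
      x ∉ X ∧ M.Indep (insert x X : Finset (Fin n)) := by
  rw [hx.contractElem_indep_iff, Finset.coe_insert, Finset.mem_coe]

theorem Unidependent.of_contract {x : Fin n} (hx : M.IsNonloop x) {U : Finset (Fin n)}
    (hU : Unidependent (M.contract {x}) U) : x ∉ U ∧ Unidependent M (insert x U) := by
  rw [unidependent_iff] at hU ⊢
  obtain ⟨hE, hd, i, hi, hI⟩ := hU
  rw [Matroid.contract_ground, Set.subset_sdiff] at hE
  have hxU : x ∉ U := by simpa using hE.2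
  have hix : x ≠ i := fun h => hxU (h ▸ hi)
  rw [contract_indep_iff hx] at hd hI
  refine ⟨hxU, ?_, fun h => hd ⟨hxU, h⟩, i, by simp [hi], ?_⟩
  · rw [Finset.coe_insert, Set.insert_subset_iff]
    exact ⟨hx.mem_ground, hE.1⟩
  · rw [Finset.erase_insert_of_ne hix]
    exact hI.2

end Unidependent

/-! ### Boundaries and their coefficients -/

section Boundary

variable (β : Fin n → Fin n → Kˣ) (χ : Finset (Fin n) → K)

/-- The `χ`-boundary without the convention for one-element sets. -/
noncomputable def rawBoundary (X : Finset (Fin n)) : Free β :=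
  ∑ i ∈ X, (posSign K i X * χ (X.erase i)) • mon β (X.erase i)

theorem boundary_eq_rawBoundary {X : Finset (Fin n)} (hX : X.card ≠ 1) :
    boundary β χ X = rawBoundary β χ X := by
  rw [boundary, if_neg hX]; rfl

/-- The convention `∂e_i = 1` only rescales the uniform formula `-χ(∅)`. Conditions up to a unit can
therefore be tested on `rawBoundary`, without a case for singletons. -/
theorem exists_boundary_eq_smul (h : χ ∅ ≠ 0) (X : Finset (Fin n)) :
    ∃ ε : Kˣ, boundary β χ X = (ε : K) • rawBoundary β χ X := by
  by_cases hX : X.card = 1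
  · obtain ⟨i, rfl⟩ := Finset.card_eq_one.1 hX
    have h0 : posSign K i {i} * χ ∅ ≠ 0 := mul_ne_zero (posSign_ne_zero _ _) h
    refine ⟨(Units.mk0 _ h0)⁻¹, ?_⟩
    rw [boundary, if_pos hX, rawBoundary, Finset.sum_singleton]
    simp only [Finset.erase_singleton, mon_empty, smul_smul, Units.val_inv_eq_inv_val,
      Units.val_mk0]
    rw [inv_mul_cancel₀ h0, one_smul]
  · exact ⟨1, by rw [boundary_eq_rawBoundary β χ hX]; simp⟩

theorem coords_sum_erase {S U : Finset (Fin n)} (hS : S ⊆ U) (c : Fin n → K) {i : Fin n}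
    (hi : i ∈ S) : coords β (∑ j ∈ S, c j • mon β (U.erase j)) (U.erase i) = c i := by
  rw [map_sum, Finsupp.finsetSum_apply, Finset.sum_eq_single_of_mem i hi]
  · rw [map_smul, coords_mon]; simp
  · intro j hj hne
    rw [map_smul, coords_mon, Finsupp.smul_apply, Finsupp.single_eq_of_ne, smul_zero]
    intro h
    have : i ∈ U.erase i := h ▸ Finset.mem_erase.2 ⟨hne.symm, hS hi⟩
    simp at this

theorem rawBoundary_mul_mon {U U' : Finset (Fin n)} (h : U' ⊆ U) :
    rawBoundary β χ U' * mon β (U \ U') = ∑ i ∈ U',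
      (posSign K i U' * χ (U'.erase i) * mulCoeff β (U'.erase i) (U \ U')) •
        mon β (U.erase i) := by
  rw [rawBoundary, Finset.sum_mul]
  refine Finset.sum_congr rfl fun i hi => ?_
  have hd : Disjoint (U'.erase i) (U \ U') :=
    Finset.disjoint_sdiff.mono_left (Finset.erase_subset _ _)
  have hU : U'.erase i ∪ U \ U' = U.erase i := by
    ext j
    have := @h j
    simp only [Finset.mem_union, Finset.mem_erase, Finset.mem_sdiff]
    by_cases hj : j = i
    · subst hj; simp [hi]
    · tauto
  rw [smul_mul_assoc, mon_mul_mon, if_pos hd, hU, smul_smul]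

/-- The sets `U \ i` are distinct, so by linear independence of the monomials the identity splits
into scalar equations with a common `ε`. The right side involves only `i ∈ U'`, and `hχ` removes the
other terms on the left. -/
theorem rawBoundary_eq_iff {U U' : Finset (Fin n)} (h : U' ⊆ U)
    (hχ : ∀ i ∈ U, i ∉ U' → χ (U.erase i) = 0) (ε : K) :
    rawBoundary β χ U = ε • (rawBoundary β χ U' * mon β (U \ U')) ↔
      ∀ i ∈ U', posSign K i U * χ (U.erase i) =
        ε * (posSign K i U' * χ (U'.erase i) * mulCoeff β (U'.erase i) (U \ U')) := by
  rw [rawBoundary_mul_mon β χ h, Finset.smul_sum]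
  simp only [smul_smul]
  constructor
  · intro heq i hi
    rw [← coords_sum_erase β h (fun i => ε * (posSign K i U' * χ (U'.erase i) *
      mulCoeff β (U'.erase i) (U \ U'))) hi, ← heq, rawBoundary, coords_sum_erase β subset_rfl _ (h hi)]
  · intro hc
    rw [rawBoundary, ← Finset.sum_subset h]
    · exact Finset.sum_congr rfl fun i hi => by rw [hc i hi]
    · intro i hi hi'
      rw [hχ i hi hi', mul_zero, zero_smul]

end Boundary

/-! ### Stability of `χ`-algebras under contraction -/

namespace IsChi

variable {M : Matroid (Fin n)} {β : Fin n → Fin n → Kˣ} {χ : Finset (Fin n) → K}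

theorem eq_zero (hχ : IsChi M β χ) {X : Finset (Fin n)} (hX : ¬ M.Indep (X : Set (Fin n))) :
    χ X = 0 :=
  not_not.1 fun h => hX ((hχ.ne_zero_iff X).1 h)

theorem empty_ne_zero (hχ : IsChi M β χ) : χ ∅ ≠ 0 := (hχ.ne_zero_iff ∅).2 (by simp)

theorem chiContract_ne_zero_iff (hχ : IsChi M β χ) {x : Fin n} (hx : M.IsNonloop x)
    (X : Finset (Fin n)) :
    chiContract χ x X ≠ 0 ↔ (M.contract {x}).Indep (X : Set (Fin n)) := by
  rw [contract_indep_iff hx]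
  by_cases hxX : x ∈ X
  · simp [chiContract, hxX]
  · rw [chiContract_of_notMem χ hxX, ← hχ.ne_zero_iff]
    simp [hxX, tailSign_ne_zero]

/-- Adjoining `x` to a unidependent set of `M/x` gives a unidependent set of `M`. Condition (b)
there, read at the coefficients of `i ≠ x`, is (b) for `M/x` up to a factor that does not depend on
`i`. -/
theorem contract (hχ : IsChi M β χ) {x : Fin n} (hx : M.IsNonloop x) :
    IsChi (M.contract {x}) β (chiContract χ x) := by
  have hne := hχ.chiContract_ne_zero_iff hx
  refine ⟨hne, fun U U' hU hU' hUU => ?_⟩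
  obtain ⟨hxU, hV⟩ := hU.of_contract hx
  obtain ⟨hxU', hV'⟩ := hU'.of_contract hx
  have hVV : insert x U' ⊆ insert x U := Finset.insert_subset_insert _ hUU
  have hsd : insert x U \ insert x U' = U \ U' := by
    rw [Finset.insert_sdiff_insert, Finset.sdiff_insert_of_notMem hxU]
  have hvan : ∀ {N : Matroid (Fin n)} {W W' : Finset (Fin n)}, Unidependent N W' → W' ⊆ W →
      ∀ i ∈ W, i ∉ W' → ¬ N.Indep (W.erase i : Set (Fin n)) := by
    intro N W W' hW' hWW i _ hi' hI
    refine (unidependent_iff.1 hW').2.1 (hI.subset ?_)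
    exact Finset.coe_subset.2 (Finset.subset_erase.2 ⟨hWW, hi'⟩)
  obtain ⟨ε, hε⟩ := hχ.boundary_eq _ _ hV hV' hVV
  obtain ⟨ε₁, h₁⟩ := exists_boundary_eq_smul β χ hχ.empty_ne_zero (insert x U)
  obtain ⟨ε₂, h₂⟩ := exists_boundary_eq_smul β χ hχ.empty_ne_zero (insert x U')
  have hraw : rawBoundary β χ (insert x U) = ((ε₁⁻¹ * ε * ε₂ : Kˣ) : K) •
      (rawBoundary β χ (insert x U') * mon β (insert x U \ insert x U')) := by
    rw [h₁, h₂, smul_mul_assoc, smul_smul] at hε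
    rw [Units.val_mul, Units.val_mul, mul_assoc, mul_smul, ← hε, smul_smul, Units.inv_mul,
      one_smul]
  rw [rawBoundary_eq_iff β χ hVV fun i hi hi' => hχ.eq_zero (hvan hV' hVV i hi hi'), hsd] at hraw
  have hx0 : (chiContract χ x) ∅ ≠ 0 := (hne ∅).2 (by simp)
  obtain ⟨δ₁, k₁⟩ := exists_boundary_eq_smul β (chiContract χ x) hx0 U
  obtain ⟨δ₂, k₂⟩ := exists_boundary_eq_smul β (chiContract χ x) hx0 U'
  -- The signs come from moving `x` to the end of `U` and of `U'`; the last factor comes from moving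
  -- `e_x` past `e_{U \ U'}`.
  set η : K := ((ε₁⁻¹ * ε * ε₂ : Kˣ) : K) * tailSign K x U * tailSign K x U' *
    moveCoeff β x (U \ U') with hη
  have hη0 : η ≠ 0 := by
    simp [hη, tailSign_ne_zero, moveCoeff_ne_zero]
  have hraw' : rawBoundary β (chiContract χ x) U =
      η • (rawBoundary β (chiContract χ x) U' * mon β (U \ U')) := by
    rw [rawBoundary_eq_iff β _ hUU fun i hi hi' =>
      not_not.1 fun h => hvan hU' hUU i hi hi' ((hne _).1 h)]
    intro i hi
    have hix : x ≠ i := fun h => hxU' (h ▸ hi)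
    have h := hraw i (by simp [hi])
    rw [Finset.erase_insert_of_ne hix, Finset.erase_insert_of_ne hix, mulCoeff,
      Finset.prod_insert (by simp [hxU'])] at h
    rw [chiContract_of_notMem χ (by simp [hxU]), chiContract_of_notMem χ (by simp [hxU']),
      mulCoeff, hη]
    linear_combination
      χ (insert x (U.erase i)) * posSign_mul_tailSign_erase (K := K) hxU (hUU hi) +
      tailSign K x U * h -
      (((ε₁⁻¹ * ε * ε₂ : Kˣ) : K) * tailSign K x U * tailSign K x U' * moveCoeff β x (U \ U') *
        χ (insert x (U'.erase i)) * ∏ j ∈ U'.erase i, moveCoeff β j (U \ U')) *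
        posSign_mul_tailSign_erase (K := K) hxU' hi -
      (tailSign K x U * ((ε₁⁻¹ * ε * ε₂ : Kˣ) : K) * posSign K i (insert x U') *
        χ (insert x (U'.erase i)) * moveCoeff β x (U \ U') *
        ∏ j ∈ U'.erase i, moveCoeff β j (U \ U')) * tailSign_mul_self (K := K) x U'
  refine ⟨δ₁ * Units.mk0 η hη0 * δ₂⁻¹, ?_⟩
  rw [k₁, k₂, hraw', smul_mul_assoc, smul_smul, smul_smul]
  congr 1
  simp [mul_assoc]

/-- Condition (b) applied to the circuit in `U` writes `∂e_U` as a multiple of a generator. Loops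
are excluded because the ideal contains `e_i` for a loop `i`, whereas `∂e_i = 1`. -/
theorem boundary_mem_chiIdeal (hχ : IsChi M β χ) {U : Finset (Fin n)} (hU : Unidependent M U)
    (hloop : ∀ i ∈ U, ¬ M.IsLoop i) : boundary β χ U ∈ chiIdeal M β χ := by
  obtain ⟨C, hC, hCU⟩ := hU.exists_circuit
  obtain ⟨ε, hε⟩ := hχ.boundary_eq U C hU (unidependent_of_isCircuit hC) hCU
  rw [hε]
  refine Submodule.smul_mem _ _ (Submodule.subset_span ⟨_, _, IdealGen.circuit C hC ?_, rfl⟩)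
  by_contra hcard
  have : C.Nonempty := by simpa using hC.nonempty
  obtain ⟨i, rfl⟩ := Finset.card_eq_one.1 (le_antisymm (not_lt.1 hcard) this.card_pos)
  exact hloop i (hCU (by simp)) (Matroid.singleton_isCircuit.1 (by simpa using hC))

end IsChi

/-! ### Parallel classes -/

section ParallelClass

/-- `y` belongs to the parallel class of `x`. -/
def InParallelClass (M : Matroid (Fin n)) (x y : Fin n) : Prop := y = x ∨ Parallel M x y

variable {M : Matroid (Fin n)} {x : Fin n}

theorem InParallelClass.isNonloop (hx : M.IsNonloop x) {y : Fin n} (h : InParallelClass M x y) :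
    M.IsNonloop y := by
  rcases h with rfl | ⟨hne, hC⟩
  · exact hx
  · exact hC.isNonloop_of_mem ⟨x, by simp, y, by simp, hne⟩ (by simp)

theorem InParallelClass.closure_eq (hx : M.IsNonloop x) {y : Fin n} (h : InParallelClass M x y) :
    M.closure {x} = M.closure {y} := by
  rcases h with rfl | ⟨hne, hC⟩
  · rfl
  · exact (hx.closure_eq_closure_iff_isCircuit_of_ne hne).2 hC

theorem inParallelClass_of_not_indep (hx : M.IsNonloop x) {y : Fin n} (hy : M.IsNonloop y)
    (h : ¬ M.Indep {x, y}) : InParallelClass M x y := by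
  by_cases hne : x = y
  · exact Or.inl hne.symm
  · refine Or.inr ⟨hne, (hx.closure_eq_closure_iff_isCircuit_of_ne hne).1 ?_⟩
    refine (hx.closure_eq_closure_iff_eq_or_dep hy).2 (Or.inr h)

/-- Elements of one parallel class have the same closure, hence lie in the same flats. -/
theorem InParallelClass.indep_insert_iff (hx : M.IsNonloop x) {y : Fin n}
    (h : InParallelClass M x y) {Z : Finset (Fin n)} (hxZ : x ∉ Z) (hyZ : y ∉ Z) :
    M.Indep (insert x Z : Finset (Fin n)) ↔ M.Indep (insert y Z : Finset (Fin n)) := by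
  rw [Finset.coe_insert, Finset.coe_insert, Matroid.insert_indep_iff, Matroid.insert_indep_iff]
  have hmem : ∀ z, M.IsNonloop z → (z ∈ M.closure Z ↔ M.closure {z} ⊆ M.closure Z) := by
    intro z hz
    rw [Matroid.closure_subset_closure_iff_subset_closure
      (by simpa using hz.mem_ground), Set.singleton_subset_iff]
  have hy := h.isNonloop hx
  simp only [Finset.mem_coe, hxZ, hyZ, not_false_eq_true, true_imp_iff, Set.mem_sdiff,
    hx.mem_ground, hy.mem_ground, true_and, hmem x hx, hmem y hy, h.closure_eq hx]

theorem InParallelClass.eq_of_indep (hx : M.IsNonloop x) {y z : Fin n}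
    (hy : InParallelClass M x y) (hz : InParallelClass M x z) {X : Set (Fin n)}
    (hX : M.Indep X) (hyX : y ∈ X) (hzX : z ∈ X) : y = z := by
  by_contra hne
  have hC := ((hy.isNonloop hx).closure_eq_closure_iff_isCircuit_of_ne hne).1
    ((hy.closure_eq hx).symm.trans (hz.closure_eq hx))
  exact hC.not_indep (hX.subset (Set.pair_subset hyX hzX))

end ParallelClass

/-! ### The residue on the free algebra -/

section ResidueLift

variable (M : Matroid (Fin n)) (β : Fin n → Fin n → Kˣ) (χ : Finset (Fin n) → K) (x : Fin n)

open Classical in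
/-- The value of the residue at `x` on the monomial `e_X`. -/
noncomputable def residueMon (X : Finset (Fin n)) :
    ChiAlgebra (M.contract {x}) β (chiContract χ x) :=
  (χ X)⁻¹ • ∑ y ∈ X with InParallelClass M x y,
    (tailSign K y (X.erase y) * chiContract χ x (X.erase y)) •
      cls (M.contract {x}) β (chiContract χ x) (X.erase y)

/-- The residue at `x`, on the free algebra. -/
noncomputable def residueLift : Free β →ₗ[K] ChiAlgebra (M.contract {x}) β (chiContract χ x) :=
  (Finsupp.linearCombination K (residueMon M β χ x)).comp (coords β)

theorem residueLift_mon (X : Finset (Fin n)) :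
    residueLift M β χ x (mon β X) = residueMon M β χ x X := by
  rw [residueLift, LinearMap.comp_apply, coords_mon, Finsupp.linearCombination_single, one_smul]

/-- The contribution to the residue of `∂ e_U` of the deletion of first `i` and then `y`. -/
noncomputable def residueTerm (U : Finset (Fin n)) (i y : Fin n) :
    ChiAlgebra (M.contract {x}) β (chiContract χ x) :=
  (posSign K i U * tailSign K y ((U.erase i).erase y) *
    chiContract χ x ((U.erase i).erase y)) •
      cls (M.contract {x}) β (chiContract χ x) ((U.erase i).erase y)

theorem residueTerm_swap {U : Finset (Fin n)} {i y : Fin n} (hi : i ∈ U) (hy : y ∈ U)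
    (hne : i ≠ y) : residueTerm M β χ x U i y + residueTerm M β χ x U y i = 0 := by
  have hU : insert i (insert y ((U.erase i).erase y)) = U := by
    rw [Finset.insert_erase (Finset.mem_erase.2 ⟨hne.symm, hy⟩), Finset.insert_erase hi]
  have h := posSign_mul_tailSign_swap (K := K) (i := i) (y := y) (W := (U.erase i).erase y)
    (by simp) (by simp) hne
  rw [hU] at h
  rw [residueTerm, residueTerm, Finset.erase_right_comm (a := y) (b := i), h, ← add_smul]
  convert! zero_smul K _ using 2
  ring

/-- With `y` fixed, moving the sign of `y` out of the sum leaves the boundary of `U \ y` for the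
contraction. -/
theorem sum_residueTerm {U : Finset (Fin n)} {y : Fin n} (hy : y ∈ U) :
    ∑ i ∈ U.erase y, residueTerm M β χ x U i y = tailSign K y (U.erase y) •
      (chiIdeal (M.contract {x}) β (chiContract χ x)).mkQ
        (rawBoundary β (chiContract χ x) (U.erase y)) := by
  rw [rawBoundary, map_sum, Finset.smul_sum]
  refine Finset.sum_congr rfl fun i hi => ?_
  have h := posSign_insert_mul_tailSign_erase (K := K) (Finset.notMem_erase y U) hi
  rw [Finset.insert_erase hy] at h
  rw [residueTerm, Finset.erase_right_comm (a := i) (b := y), h, map_smul, smul_smul, cls,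
    mul_assoc]

end ResidueLift

/-! ### The residue descends to the quotient -/

section Existence

variable {M : Matroid (Fin n)} {β : Fin n → Fin n → Kˣ} {χ : Finset (Fin n) → K} {x : Fin n}

/-- The convention `0⁻¹ = 0` makes the single formula for `residueMon` vanish on dependent sets. -/
theorem residueMon_of_not_indep (hχ : IsChi M β χ) {X : Finset (Fin n)}
    (hX : ¬ M.Indep (X : Set (Fin n))) : residueMon M β χ x X = 0 := by
  rw [residueMon, hχ.eq_zero hX, inv_zero, zero_smul]

-- The coefficient `χ(U \ i)` of the boundary cancels the inverse in `residueMon`. This is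
-- legitimate wherever the term is nonzero: `y` can replace `x`, so independence of `U \ {i, y}` in
-- `M/x` gives independence of `U \ i` in `M`. It remains to exchange the two sums.
open Classical in
theorem residueLift_rawBoundary (hχ : IsChi M β χ) (hx : M.IsNonloop x) (U : Finset (Fin n)) :
    residueLift M β χ x (rawBoundary β χ U) =
      ∑ y ∈ U with InParallelClass M x y, ∑ i ∈ U.erase y, residueTerm M β χ x U i y := by
  have h1 : residueLift M β χ x (rawBoundary β χ U) =
      ∑ i ∈ U, ∑ y ∈ U.erase i with InParallelClass M x y, residueTerm M β χ x U i y := by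
    rw [rawBoundary, map_sum]
    refine Finset.sum_congr rfl fun i _ => ?_
    rw [map_smul, residueLift_mon, residueMon, smul_smul, Finset.smul_sum]
    refine Finset.sum_congr rfl fun y hy => ?_
    rw [Finset.mem_filter] at hy
    rw [residueTerm, smul_smul]
    congr 1
    by_cases h0 : chiContract χ x ((U.erase i).erase y) = 0
    · simp [h0]
    · have h2 := (contract_indep_iff hx).1 ((hχ.chiContract_ne_zero_iff hx _).1 h0)
      rw [hy.2.indep_insert_iff hx h2.1 (Finset.notMem_erase _ _), Finset.insert_erase hy.1,
        ← hχ.ne_zero_iff] at h2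
      rw [mul_assoc (posSign K i U), mul_inv_cancel₀ h2.2, mul_one, mul_assoc]
  rw [h1]
  refine Finset.sum_comm' fun i y => ?_
  simp only [Finset.mem_filter, Finset.mem_erase]
  tauto

theorem residueLift_rawBoundary_eq_zero (hχ : IsChi M β χ) (hx : M.IsNonloop x)
    {U : Finset (Fin n)} (hU : Unidependent M U) (hloop : ∀ i ∈ U, ¬ M.IsLoop i) :
    residueLift M β χ x (rawBoundary β χ U) = 0 := by
  classical
  rw [residueLift_rawBoundary hχ hx]
  have hcx := hχ.chiContract_ne_zero_iff hx
  by_cases h2 : ∃ y ∈ U, ∃ z ∈ U, InParallelClass M x y ∧ InParallelClass M x z ∧ y ≠ z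
  -- Two members of the class: if `i` lies outside it, a member `z ≠ y` survives both deletions and
  -- is dependent with `x`, so the term vanishes. What is left is symmetric in `i` and `y` and
  -- cancels in pairs.
  · have h3 : ∀ y ∈ U.filter (InParallelClass M x), ∑ i ∈ U.erase y, residueTerm M β χ x U i y =
        ∑ i ∈ (U.filter (InParallelClass M x)).erase y, residueTerm M β χ x U i y := by
      intro y hy
      rw [Finset.mem_filter] at hy
      refine (Finset.sum_subset (Finset.erase_subset_erase _ (Finset.filter_subset _ _)) ?_).symm
      intro i hi hi'
      simp only [Finset.mem_erase, Finset.mem_filter] at hi hi'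
      obtain ⟨z, hzU, hz, hzy⟩ : ∃ z ∈ U, InParallelClass M x z ∧ z ≠ y := by
        obtain ⟨a, ha, b, hb, hpa, hpb, hab⟩ := h2
        by_cases hay : a = y
        · exact ⟨b, hb, hpb, fun h => hab (hay.trans h.symm)⟩
        · exact ⟨a, ha, hpa, hay⟩
      have hzi : z ≠ i := fun h => hi' ⟨hi.1, hi.2, h ▸ hz⟩
      have hzW : z ∈ (U.erase i).erase y := by simp [hzU, hzy, hzi]
      have h0 : chiContract χ x ((U.erase i).erase y) = 0 := by
        by_contra h0
        have h4 := (contract_indep_iff hx).1 ((hcx _).1 h0)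
        have := InParallelClass.eq_of_indep hx (Or.inl rfl) hz h4.2 (by simp)
          (by rw [Finset.mem_coe]; exact Finset.mem_insert_of_mem hzW)
        exact h4.1 (this ▸ hzW)
      rw [residueTerm, h0, mul_zero, zero_smul]
    rw [Finset.sum_congr rfl h3, Finset.sum_sigma']
    refine Finset.sum_involution (fun p _ => ⟨p.2, p.1⟩) ?_ ?_ ?_ ?_
    · rintro ⟨y, i⟩ hp
      simp only [Finset.mem_sigma, Finset.mem_erase, Finset.mem_filter] at hp
      exact residueTerm_swap M β χ x hp.2.2.1 hp.1.1 hp.2.1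
    · rintro ⟨y, i⟩ hp - h
      simp only [Finset.mem_sigma, Finset.mem_erase, Finset.mem_filter] at hp
      simp only [Sigma.mk.injEq] at h
      exact hp.2.1 h.1
    · rintro ⟨y, i⟩ hp
      simp only [Finset.mem_sigma, Finset.mem_erase, Finset.mem_filter] at hp ⊢
      exact ⟨hp.2.2, hp.2.1.symm, hp.1⟩
    · rintro ⟨y, i⟩ hp
      rfl
  -- At most one member `y`: its inner sum is a signed boundary of `U \ y`, to be shown zero in the
  -- quotient for `M/x`.
  · refine Finset.sum_eq_zero fun y hy => ?_
    rw [Finset.mem_filter] at hy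
    have huniq : ∀ z ∈ U, InParallelClass M x z → z = y := fun z hz hpz => by
      by_contra hne
      exact h2 ⟨z, hz, y, hy.1, hpz, hy.2, hne⟩
    have hxU : x ∉ U.erase y := fun h =>
      (Finset.mem_erase.1 h).1 (huniq x (Finset.mem_erase.1 h).2 (Or.inl rfl))
    rw [sum_residueTerm M β χ x hy.1]
    by_cases hi : ∃ i ∈ U.erase y, chiContract χ x ((U.erase y).erase i) ≠ 0
    · have hV : Unidependent (M.contract {x}) (U.erase y) := by
        obtain ⟨hUE, hUd, -⟩ := unidependent_iff.1 hU
        obtain ⟨i, hi, hi0⟩ := hi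
        refine unidependent_iff.2 ⟨?_, ?_, i, hi, (hcx _).1 hi0⟩
        · rw [Matroid.contract_ground, Set.subset_sdiff]
          exact ⟨(Finset.coe_subset.2 (Finset.erase_subset _ _)).trans hUE, by rwa [Set.disjoint_singleton_right, Finset.mem_coe]⟩
        · rw [contract_indep_iff hx, hy.2.indep_insert_iff hx hxU (Finset.notMem_erase _ _),
            Finset.insert_erase hy.1]
          exact fun h => hUd h.2
      -- A loop of `M/x` that is not a loop of `M` is in the parallel class of `x`, where `U` has
      -- only `y`.
      have hVloop : ∀ i ∈ U.erase y, ¬ (M.contract {x}).IsLoop i := by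
        intro i hi hil
        have hi' := Finset.mem_erase.1 hi
        have hiE : i ∈ M.E := hU.1 hi'.2
        refine hi'.1 (huniq i hi'.2 (inParallelClass_of_not_indep hx
          ((Matroid.not_isLoop_iff hiE).1 (hloop i hi'.2)) fun hind => ?_))
        refine hil.not_indep_of_mem (X := (({i} : Finset (Fin n)) : Set (Fin n))) (by simp) ?_
        rw [contract_indep_iff hx]
        refine ⟨fun h => hxU (Finset.mem_singleton.1 h ▸ hi), by simpa using hind⟩
      have hmem := (hχ.contract hx).boundary_mem_chiIdeal hV hVloop
      obtain ⟨ε, hε⟩ := exists_boundary_eq_smul β _ (hχ.contract hx).empty_ne_zero (U.erase y)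
      rw [hε, Submodule.smul_mem_iff _ ε.ne_zero] at hmem
      rw [Submodule.mkQ_apply, (Submodule.Quotient.mk_eq_zero _).2 hmem, smul_zero]
    · push Not at hi
      rw [rawBoundary, Finset.sum_eq_zero, map_zero, smul_zero]
      intro i hiU
      rw [hi i hiU, mul_zero, zero_smul]

theorem residueLift_boundary_mul_mon (hχ : IsChi M β χ) (hx : M.IsNonloop x)
    {C : Finset (Fin n)} (hC : M.IsCircuit (C : Set (Fin n))) (hcard : 1 < C.card)
    (Y : Finset (Fin n)) : residueLift M β χ x (boundary β χ C * mon β Y) = 0 := by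
  -- If this holds, the product is a multiple of `∂e_{C ∪ Y}` by (b). Otherwise each term is zero in
  -- the free algebra or a dependent monomial: an independent `(C \ i) ∪ Y` disjointly formed would
  -- force `i ∉ Y` and make `C ∪ Y` unidependent.
  by_cases hU : Unidependent M (C ∪ Y) ∧ Disjoint C Y
  · obtain ⟨ε, hε⟩ := hχ.boundary_eq _ _ hU.1 (unidependent_of_isCircuit hC)
      Finset.subset_union_left
    rw [Finset.union_sdiff_cancel_left hU.2] at hε
    have hcard' : (C ∪ Y).card ≠ 1 :=
      (hcard.trans_le (Finset.card_le_card Finset.subset_union_left)).ne'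
    have h0 := residueLift_rawBoundary_eq_zero hχ hx hU.1 fun i hi hl => by
      have hCi := Matroid.singleton_isCircuit.2 hl
      have h1 := hU.1.2.unique ⟨hCi, by simpa using hi⟩
        ⟨hC, Finset.coe_subset.2 Finset.subset_union_left⟩
      have : C = {i} := by
        rw [← Finset.coe_inj, ← h1, Finset.coe_singleton]
      rw [this, Finset.card_singleton] at hcard
      exact lt_irrefl _ hcard
    rw [← boundary_eq_rawBoundary β χ hcard', hε, map_smul] at h0
    exact (smul_eq_zero.1 h0).resolve_left ε.ne_zero
  · rw [boundary_eq_rawBoundary β χ hcard.ne', rawBoundary, Finset.sum_mul, map_sum]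
    refine Finset.sum_eq_zero fun i hi => ?_
    rw [smul_mul_assoc, map_smul, mon_mul_mon]
    split_ifs with hd
    · rw [map_smul, residueLift_mon, residueMon_of_not_indep hχ, smul_zero, smul_zero]
      intro hI
      have hiY : i ∉ Y := fun h => by
        refine hC.not_indep (hI.subset ?_)
        intro j hj
        by_cases hji : j = i
        · subst hji; simp [h]
        · have : j ∈ C := hj
          simp [this, hji]
      refine hU ⟨unidependent_iff.2 ⟨?_, ?_, i, by simp [hi], ?_⟩, ?_⟩
      · have h1 := hI.subset_ground
        rw [Finset.coe_union, Set.union_subset_iff] at h1 ⊢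
        exact ⟨hC.subset_ground, h1.2⟩
      · exact fun h => hC.not_indep (h.subset (Finset.coe_subset.2 Finset.subset_union_left))
      · rwa [Finset.erase_union_distrib, Finset.erase_eq_of_notMem hiY]
      · rw [← Finset.insert_erase hi, Finset.disjoint_insert_left]
        exact ⟨hiY, hd⟩
    · simp

theorem chiIdeal_le_ker_residueLift (hχ : IsChi M β χ) (hx : M.IsNonloop x) :
    chiIdeal M β χ ≤ LinearMap.ker (residueLift M β χ x) := by
  rw [chiIdeal, Submodule.span_le]
  rintro z ⟨g, a, hg, rfl⟩
  suffices h : (residueLift M β χ x).comp (LinearMap.mulLeft K g) = 0 from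
    LinearMap.congr_fun h a
  refine LinearMap.ext_on_range (span_mon β) fun Y => ?_
  rw [LinearMap.comp_apply, LinearMap.mulLeft_apply, LinearMap.zero_apply]
  have hgen : ∀ i, (∀ X : Set (Fin n), i ∈ X → ¬ M.Indep X) →
      residueLift M β χ x (gen β i * mon β Y) = 0 := by
    intro i hi
    rw [gen_mul_mon]
    split_ifs
    · simp
    · rw [map_smul, residueLift_mon, residueMon_of_not_indep hχ (hi _ (by simp)), smul_zero]
  cases hg with
  | circuit C hC hcard => exact residueLift_boundary_mul_mon hχ hx hC hcard Y
  | loop i hi =>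
    exact hgen i fun X hiX hX => hi.not_indep (hX.subset (by simpa using hiX))
  | outside i hi => exact hgen i fun X hiX hX => hi (hX.subset_ground hiX)

/-- An independent set contains at most one member of a parallel class, so the sum has a single
term; tail signs are their own inverses. Both nonzero cases of the residue formula follow. -/
theorem residueMon_of_mem (hχ : IsChi M β χ) (hx : M.IsNonloop x) {I : Finset (Fin n)}
    (hI : M.Indep (I : Set (Fin n))) {y : Fin n} (hy : y ∈ I) (hp : InParallelClass M x y) :
    residueMon M β χ x I =
      (chiContract χ x (I.erase y) / chiOrd χ (snoc (I.erase y) y)) •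
        cls (M.contract {x}) β (chiContract χ x) (I.erase y) := by
  classical
  have hfilter : I.filter (InParallelClass M x) = {y} := by
    ext z
    rw [Finset.mem_filter, Finset.mem_singleton]
    constructor
    · exact fun h => h.2.eq_of_indep hx hp hI h.1 hy
    · rintro rfl
      exact ⟨hy, hp⟩
  rw [residueMon]
  simp only [hfilter]
  rw [Finset.sum_singleton, smul_smul, chiOrd_snoc χ (Finset.notMem_erase y I),
    Finset.insert_erase hy]
  congr 1
  have h1 := (hχ.ne_zero_iff I).2 hI
  have h2 := tailSign_ne_zero (K := K) y (I.erase y)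
  field_simp
  rw [pow_two, tailSign_mul_self, one_mul]

theorem exists_isResidue (hχ : IsChi M β χ) (hx : M.IsNonloop x) :
    ∃ f, IsResidue M β χ x f := by
  refine ⟨(chiIdeal M β χ).liftQ (residueLift M β χ x) (chiIdeal_le_ker_residueLift hχ hx), ?_⟩
  have hval : ∀ I : Finset (Fin n), (chiIdeal M β χ).liftQ (residueLift M β χ x)
      (chiIdeal_le_ker_residueLift hχ hx) (cls M β χ I) = residueMon M β χ x I := fun I => by
    rw [cls, Submodule.mkQ_apply, Submodule.liftQ_apply, residueLift_mon]
  constructor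
  · intro I hI hxI
    rw [hval, residueMon_of_mem hχ hx hI hxI (Or.inl rfl), chiContract,
      if_neg (Finset.notMem_erase x I), div_self, one_smul]
    rw [chiOrd_snoc χ (Finset.notMem_erase x I), Finset.insert_erase hxI]
    exact mul_ne_zero (tailSign_ne_zero _ _) ((hχ.ne_zero_iff I).2 hI)
  · intro I hI y hy hp
    have hxI : x ∉ I.erase y := fun h =>
      hp.1 (InParallelClass.eq_of_indep hx (Or.inl rfl) (Or.inr hp) hI
        (Finset.mem_of_mem_erase h) hy)
    rw [hval, residueMon_of_mem hχ hx hI hy (Or.inr hp), chiContract, if_neg hxI]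
  · intro I hI hxI hpar
    classical
    rw [hval, residueMon, Finset.filter_false_of_mem, Finset.sum_empty, smul_zero]
    rintro y hy (rfl | hp)
    · exact hxI hy
    · exact hpar y hy hp

theorem isResidue_residue (hχ : IsChi M β χ) (hx : M.IsNonloop x) :
    IsResidue M β χ x (residue M β χ x) := by
  have h := exists_isResidue hχ hx
  rw [residue, dif_pos h]
  exact h.choose_spec

end Existence

/-! ### Iterated residues and flags -/

section IteratedResidues

variable {β : Fin n → Fin n → Kˣ}

/-- Residues read an ordered set from its end. In that order the flag consists of the closures of
the nonempty prefixes, which suits induction on contractions. -/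
theorem flag_reverse (M : Matroid (Fin n)) (R : List (Fin n)) :
    flag M R.reverse =
      (List.range R.length).map fun k => M.closure {y | y ∈ R.take (k + 1)} := by
  induction R using List.reverseRecOn with
  | nil => rfl
  | append_singleton R x ih =>
    rw [List.reverse_append, List.reverse_singleton, List.singleton_append, flag, ih,
      List.length_append, List.length_singleton, List.range_succ, List.map_append]
    congr 1
    · refine List.map_congr_left fun k hk => ?_
      rw [List.take_append_of_le_length (List.mem_range.1 hk)]
    · rw [List.map_singleton, List.take_of_length_le (by simp)]
      congr 2
      ext y
      simp [or_comm]

theorem residues_toFinset (R : List (Fin n)) : ∀ (M : Matroid (Fin n)) (χ : Finset (Fin n) → K),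
    IsChi M β χ → R.Nodup → M.Indep {y | y ∈ R} →
      residues β R M χ (cls M β χ R.toFinset) = 1 := by
  induction R with
  | nil =>
    intro M χ _ _ _
    simp [residues, degreeZero, cls]
  | cons x R ih =>
    intro M χ hχ hR hI
    have hx : M.IsNonloop x := hI.isNonloop_of_mem (by simp)
    have hset : {y | y ∈ x :: R} = insert x {y | y ∈ R} := by ext; simp
    rw [List.nodup_cons] at hR
    have herase : (x :: R).toFinset.erase x = R.toFinset := by
      rw [List.toFinset_cons, Finset.erase_insert (by simpa using hR.1)]
    rw [residues, LinearMap.comp_apply, (isResidue_residue hχ hx).of_mem _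
      (by rwa [List.coe_toFinset]) (by simp), herase]
    refine ih _ _ (hχ.contract hx) hR.2 ?_
    rw [hx.contractElem_indep_iff, ← hset]
    exact ⟨hR.1, hI⟩

/-- Each nonzero step removes from `J` one element in the parallel class of the contracted `x`;
listing these elements in order of removal gives `L`. -/
theorem exists_ordering_of_residues_ne_zero (R : List (Fin n)) :
    ∀ (M : Matroid (Fin n)) (χ : Finset (Fin n) → K) (J : Finset (Fin n)), IsChi M β χ → R.Nodup →
      M.Indep {y | y ∈ R} → M.Indep (J : Set (Fin n)) → J.card = R.length →
      residues β R M χ (cls M β χ J) ≠ 0 →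
      ∃ L, IsOrdering L J ∧
        ∀ k, M.closure {y | y ∈ L.take k} = M.closure {y | y ∈ R.take k} := by
  induction R with
  | nil =>
    intro M χ J _ _ _ _ hcard _
    obtain rfl := Finset.card_eq_zero.1 hcard
    exact ⟨[], ⟨List.nodup_nil, rfl⟩, fun k => rfl⟩
  | cons x R ih =>
    intro M χ J hχ hR hI hJ hcard hne
    have hx : M.IsNonloop x := hI.isNonloop_of_mem (by simp)
    have hset : {y | y ∈ x :: R} = insert x {y | y ∈ R} := by ext; simp
    rw [List.nodup_cons] at hR
    have hres := isResidue_residue hχ hx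
    rw [residues, LinearMap.comp_apply] at hne
    obtain ⟨y, hy, hp, hne⟩ : ∃ y ∈ J, InParallelClass M x y ∧
        residues β R (M.contract {x}) (chiContract χ x)
          (cls (M.contract {x}) β (chiContract χ x) (J.erase y)) ≠ 0 := by
      by_cases hxJ : x ∈ J
      · rw [hres.of_mem J hJ hxJ] at hne
        exact ⟨x, hxJ, Or.inl rfl, hne⟩
      · by_cases hpar : ∃ y ∈ J, Parallel M x y
        · obtain ⟨y, hy, hp⟩ := hpar
          rw [hres.of_parallel J hJ y hy hp, map_smul] at hne
          exact ⟨y, hy, Or.inr hp, right_ne_zero_of_smul hne⟩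
        · push Not at hpar
          rw [hres.otherwise J hJ hxJ hpar, map_zero] at hne
          exact absurd rfl hne
    have hxy : x ∉ J.erase y := fun h => (Finset.mem_erase.1 h).1
      (InParallelClass.eq_of_indep hx (Or.inl rfl) hp hJ (Finset.mem_of_mem_erase h) hy)
    obtain ⟨L, hL, hcl⟩ := ih (M.contract {x}) (chiContract χ x) (J.erase y) (hχ.contract hx) hR.2
      (by rw [hx.contractElem_indep_iff, ← hset]; exact ⟨hR.1, hI⟩)
      (by
        rw [contract_indep_iff hx, hp.indep_insert_iff hx hxy (Finset.notMem_erase _ _),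
          Finset.insert_erase hy]
        exact ⟨hxy, hJ⟩)
      (by rw [Finset.card_erase_of_mem hy, hcard]; simp) hne
    refine ⟨y :: L, ⟨List.nodup_cons.2 ⟨fun h => ?_, hL.1⟩, ?_⟩, fun k => ?_⟩
    · have : y ∈ J.erase y := hL.2 ▸ List.mem_toFinset.2 h
      simp at this
    · rw [List.toFinset_cons, hL.2, Finset.insert_erase hy]
    · cases k with
      | zero => rfl
      | succ k =>
        have hcons : ∀ (z : Fin n) (S : List (Fin n)),
            {w | w ∈ (z :: S).take (k + 1)} = {w | w ∈ S.take k} ∪ {z} := by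
          intro z S
          ext w
          simp
        have h1 := hcl k
        rw [Matroid.contract_closure_eq, Matroid.contract_closure_eq] at h1
        have hmem : ∀ S : Set (Fin n), {x} ⊆ M.closure (S ∪ {x}) := fun S =>
          Set.singleton_subset_iff.2 (M.mem_closure_of_mem' (by simp) hx.mem_ground)
        -- Replace `y` by the parallel `x`. A closure in `M/x` is the closure in `M` after adjoining
        -- `x`, with `x` removed, so restoring `x` lifts the induction hypothesis to `M`.
        rw [hcons, hcons, ← M.closure_union_congr_right (hp.closure_eq hx),
          ← Set.sdiff_union_of_subset (hmem _), h1, Set.sdiff_union_of_subset (hmem _)]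

end IteratedResidues

/-! ### Duality for a diagonal basis -/

section DiagonalBasis

variable {M : Matroid (Fin n)} {β : Fin n → Fin n → Kˣ} {χ : Finset (Fin n) → K} {ℓ : ℕ}
  {𝕀 : Finset (Finset (Fin n))} {ord : Finset (Fin n) → List (Fin n)}

instance finite_component : Module.Finite K (component M β χ ℓ) := by
  refine Module.Finite.span_of_finite K ((Set.finite_range (cls M β χ)).subset ?_)
  rintro _ ⟨I, -, -, rfl⟩
  exact ⟨I, rfl⟩

theorem IsDiagonalBasis.residues_cls (hχ : IsChi M β χ) (h : IsDiagonalBasis M β χ ℓ 𝕀 ord)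
    {I J : Finset (Fin n)} (hI : I ∈ 𝕀) (hJ : J ∈ 𝕀) :
    residues β (ord I).reverse M χ (cls M β χ J) = if J = I then 1 else 0 := by
  obtain ⟨hnd, hto⟩ := h.ordering I hI
  have hnd' : (ord I).reverse.Nodup := List.nodup_reverse.2 hnd
  have hto' : (ord I).reverse.toFinset = I := by rw [List.toFinset_reverse, hto]
  have hind : M.Indep {y | y ∈ (ord I).reverse} := by
    have : {y | y ∈ (ord I).reverse} = (I : Set (Fin n)) := by
      rw [← List.coe_toFinset, hto']
    rw [this]
    exact h.indep I hI
  have hlen : (ord I).reverse.length = ℓ := by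
    rw [← List.toFinset_card_of_nodup hnd', hto', h.card_eq I hI]
  split_ifs with hJI
  · subst hJI
    have := residues_toFinset (ord J).reverse M χ hχ hnd' hind
    rwa [hto'] at this
  · by_contra hne
    obtain ⟨L, hL, hcl⟩ := exists_ordering_of_residues_ne_zero _ M χ J hχ hnd' hind
      (h.indep J hJ) ((h.card_eq J hJ).trans hlen.symm) hne
    refine hJI (h.eq_of_flag_eq I hI J hJ L.reverse ⟨List.nodup_reverse.2 hL.1, ?_⟩ ?_)
    · rw [List.toFinset_reverse, hL.2]
    · have hlen' : L.length = ℓ := by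
        rw [← List.toFinset_card_of_nodup hL.1, hL.2, h.card_eq J hJ]
      rw [flag_reverse, ← List.reverse_reverse (ord I), flag_reverse, hlen, hlen']
      exact List.map_congr_left fun k _ => hcl (k + 1)

end DiagonalBasis

end ChiAlg

theorem mainTheorem5 {n : ℕ} {K : Type*} [Field K] (M : Matroid (Fin n)) (hE : M.E = Set.univ)
    (β : Fin n → Fin n → Kˣ) (χ : Finset (Fin n) → K) (hχ : ChiAlg.IsChi M β χ) (ℓ : ℕ)
    (𝕀 : Finset (Finset (Fin n))) (ord : Finset (Fin n) → List (Fin n))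
    (h𝕀 : ChiAlg.IsDiagonalBasis M β χ ℓ 𝕀 ord) :
    ∃ b : Module.Basis 𝕀 K (ChiAlg.component M β χ ℓ),
      (∀ I : 𝕀, (b I : ChiAlg.ChiAlgebra M β χ) = ChiAlg.cls M β χ I) ∧
      ∀ I : 𝕀, b.dualBasis I = ChiAlg.iteratedResidue M β χ ℓ (ord I) := by
  let v : 𝕀 → ChiAlg.component M β χ ℓ := fun I =>
    ⟨ChiAlg.cls M β χ I, ChiAlg.cls_mem_component M β χ (h𝕀.indep I I.2) (h𝕀.card_eq I I.2)⟩
  have hdual : ∀ I J : 𝕀,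
      ChiAlg.iteratedResidue M β χ ℓ (ord I) (v J) = if J = I then 1 else 0 := fun I J => by
    rw [ChiAlg.iteratedResidue, LinearMap.domRestrict_apply]
    simpa only [Subtype.ext_iff] using h𝕀.residues_cls hχ I.2 J.2
  have hv : LinearIndependent K v := by
    rw [Fintype.linearIndependent_iff]
    intro g hg I
    have h := congrArg (ChiAlg.iteratedResidue M β χ ℓ (ord I)) hg
    rw [map_sum, map_zero] at h
    simpa [hdual] using h
  -- Independence gives one inequality, condition (2) the other.
  have hcard : Fintype.card 𝕀 = Module.finrank K (ChiAlg.component M β χ ℓ) :=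
    le_antisymm hv.fintype_card_le_finrank (by simpa using h𝕀.finrank_le)
  let b := Module.Basis.mk hv (hv.span_eq_top_of_card_eq_finrank' hcard).ge
  have hb : ∀ I, b I = v I := fun I => Module.Basis.mk_apply _ _ I
  refine ⟨b, fun I => by rw [hb], fun I => b.ext fun J => ?_⟩
  rw [Module.Basis.dualBasis_apply_self, hb, hdual]
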